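/- A finite word $w$ is a $\beta$-power, for a rational number $\beta$, if $w = x^n x'$ for some nonempty word $x$, some integer $n \ge 0$ and some prefix $x'$ of $x$ with $\beta = n + |x'|/|x|$; a $2$-power is called a square. For a real number $\alpha$, an infinite word is $\alpha$-power-free if none of its finite subwords (blocks of consecutive letters) is a $\beta$-power for any rational $\beta \ge \alpha$. Theorem. For every real number $\alpha > 2$ there exists an infinite $\alpha$-power-free binary word $\mathbf{a} = a_0 a_1 a_2 \cdots$ that contains squares beginning at every position, that is, for every $i \ge 0$ there is an $m \ge 1$ such that $a_i a_{i+1} \cdots a_{i+m-1}$ is a square. -/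

import Mathlib

namespace InfWord

/-- The word `w` is a `β`-power: `w = xⁿx'` with `x` nonempty, `x'` a prefix of `x`, and
`β = n + |x'| / |x|`. -/
def IsPower {A : Type*} (w : List A) (β : ℚ) : Prop :=
  ∃ (x x' : List A) (n : ℕ), x ≠ [] ∧ x' <+: x ∧
    w = (List.replicate n x).flatten ++ x' ∧
    β = (n : ℚ) + (x'.length : ℚ) / (x.length : ℚ)

/-- A square is a `2`-power. -/
def IsSquareWord {A : Type*} (w : List A) : Prop :=
  IsPower w 2

/-- The subword `a i, a (i + 1), …, a (i + m - 1)` of length `m` of the infinite word `a` that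
begins at position `i`. -/
def subword {A : Type*} (a : ℕ → A) (i m : ℕ) : List A :=
  (List.range m).map fun k => a (i + k)

/-- For real `α`, the infinite word `a` is `α`-power-free: none of its subwords is a `β`-power
for a rational number `β ≥ α`. -/
def PowerFree {A : Type*} (a : ℕ → A) (α : ℝ) : Prop :=
  ∀ β : ℚ, α ≤ (β : ℝ) → ∀ i m : ℕ, ¬ IsPower (subword a i m) β

/-- Some square begins at position `i` of the infinite word `a`. -/
def HasSquareAt {A : Type*} (a : ℕ → A) (i : ℕ) : Prop :=
  ∃ m : ℕ, IsSquareWord (subword a i m)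

end InfWord

namespace InfWord

/-! Let `μ` be the Thue–Morse morphism and `w = 0 μˢ(w)` with `s` even and positive, `N = 2ˢ`. The
word `w` starts with an overlap, and `μˢ` carries overlaps forward to every later position
(`exists_overlap_overlapWord`), so squares begin everywhere. Conversely, an overlap in `μˢ(w)` of
period `p` comes from one in `w` of period `p / N`, so descent bounds every exponent by `2 + 4 / N`
(`overlapWord_overlap_bound`); a large `s` brings this below `α`. -/

/-- The Thue–Morse morphism `0 ↦ 01`, `1 ↦ 10` on infinite binary words. -/
def thueMorse (u : ℕ → Fin 2) (n : ℕ) : Fin 2 :=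
  u (n / 2) + if n % 2 = 0 then 0 else 1

/-- `a j = a (j + p)` for all `j` in `[i, m)`; that is, `a i ⋯ a (m + p - 1)` has period `p`. -/
def PeriodicOn (a : ℕ → Fin 2) (i m p : ℕ) : Prop :=
  ∀ j, i ≤ j → j < m → a j = a (j + p)

theorem thueMorse_even (u : ℕ → Fin 2) (n : ℕ) : thueMorse u (2 * n) = u n := by
  simp [thueMorse]

theorem thueMorse_odd (u : ℕ → Fin 2) (n : ℕ) : thueMorse u (2 * n + 1) = u n + 1 := by
  have h : (2 * n + 1) / 2 = n := by omega
  simp [thueMorse, h, Nat.add_mod]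

theorem thueMorse_succ_of_even (u : ℕ → Fin 2) {j : ℕ} (hj : Even j) :
    thueMorse u (j + 1) = thueMorse u j + 1 := by
  obtain ⟨n, rfl⟩ := hj.two_dvd
  rw [thueMorse_odd, thueMorse_even]

theorem fin_two_add_one_ne (x : Fin 2) : x + 1 ≠ x := by
  revert x; decide

theorem iterate_thueMorse (s : ℕ) (u : ℕ → Fin 2) (n : ℕ) :
    thueMorse^[s] u n = u (n / 2 ^ s) + thueMorse^[s] (fun _ => 0) n := by
  induction s generalizing n with
  | zero => simp
  | succ s ih =>
    rw [Function.iterate_succ_apply', Function.iterate_succ_apply', thueMorse, ih, thueMorse,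
      Nat.div_div_eq_div_mul, ← pow_succ', add_assoc]

theorem iterate_thueMorse_zero (s : ℕ) (u : ℕ → Fin 2) : thueMorse^[s] u 0 = u 0 := by
  induction s with
  | zero => rfl
  | succ s ih => rw [Function.iterate_succ_apply', ← ih]; exact thueMorse_even _ 0

/-- Each application of `μ` flips the last letter of a block, so an even number of them restores it.
This is why even exponents are used. -/
theorem iterate_thueMorse_last (k : ℕ) (u : ℕ → Fin 2) :
    thueMorse^[2 * k] u (2 ^ (2 * k) - 1) = u 0 := by
  induction k with
  | zero => rfl
  | succ k ih =>
    have h1 : 2 ^ (2 * (k + 1)) - 1 = 2 * (2 * (2 ^ (2 * k) - 1) + 1) + 1 := by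
      have := Nat.one_le_two_pow (n := 2 * k)
      rw [show 2 * (k + 1) = 2 * k + 2 by ring, pow_add]
      omega
    rw [h1, show 2 * (k + 1) = 2 * k + 1 + 1 by ring, Function.iterate_succ_apply',
      thueMorse_odd, Function.iterate_succ_apply', thueMorse_odd, ih]
    generalize u 0 = x
    revert x; decide

theorem PeriodicOn.thueMorse {u : ℕ → Fin 2} {i m p : ℕ} (h : PeriodicOn u i m p) :
    PeriodicOn (thueMorse u) (2 * i) (2 * m) (2 * p) := by
  intro j hj hm
  rw [InfWord.thueMorse, InfWord.thueMorse, Nat.add_mul_mod_self_left,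
    Nat.add_mul_div_left _ _ two_pos, h (j / 2) (by omega) (by omega)]

theorem PeriodicOn.iterate_thueMorse {u : ℕ → Fin 2} {i m p : ℕ} (h : PeriodicOn u i m p)
    (s : ℕ) : PeriodicOn (InfWord.thueMorse^[s] u) (2 ^ s * i) (2 ^ s * m) (2 ^ s * p) := by
  induction s with
  | zero => simpa using h
  | succ s ih =>
    rw [Function.iterate_succ_apply']
    simpa only [pow_succ', mul_assoc] using ih.thueMorse

/-- Either letter of a block `μ(x)` determines `x`, so both ends round outward to whole blocks. -/
theorem PeriodicOn.of_thueMorse {u : ℕ → Fin 2} {i m q : ℕ} (him : i < m)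
    (h : PeriodicOn (InfWord.thueMorse u) i m (2 * q)) :
    PeriodicOn u (i / 2) ((m + 1) / 2) q := by
  intro j hj hm
  by_cases hij : i ≤ 2 * j
  · have := h (2 * j) hij (by omega)
    rwa [← mul_add, thueMorse_even, thueMorse_even] at this
  · have := h (2 * j + 1) (by omega) (by omega)
    rw [show 2 * j + 1 + 2 * q = 2 * (j + q) + 1 by ring, thueMorse_odd, thueMorse_odd] at this
    exact add_right_cancel this

/-- Every overlap in the image of the Thue–Morse morphism has even period. -/
theorem PeriodicOn.even_of_overlap {u : ℕ → Fin 2} {i m p : ℕ} (him : i + p < m)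
    (h : PeriodicOn (InfWord.thueMorse u) i m p) : Even p := by
  by_contra hp
  rw [Nat.not_even_iff_odd] at hp
  -- A pair starting at an even position is a block, so its letters differ; an odd shift `p` moves
  -- pairs at odd positions onto blocks.
  have alt : ∀ j, i ≤ j → j < i + p →
      InfWord.thueMorse u (j + 1) = InfWord.thueMorse u j + 1 := by
    intro j hij hj
    rcases Nat.even_or_odd j with he | ho
    · exact thueMorse_succ_of_even u he
    · rw [h j hij (by omega), h (j + 1) (by omega) (by omega), add_right_comm]
      exact thueMorse_succ_of_even u (ho.add_odd hp)
  have alt' : ∀ k ≤ p, InfWord.thueMorse u (i + k)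
      = InfWord.thueMorse u i + if k % 2 = 0 then 0 else 1 := by
    intro k
    induction k with
    | zero => simp
    | succ k ih =>
      intro hk
      rw [← add_assoc, alt (i + k) (by omega) (by omega), ih (by omega)]
      generalize InfWord.thueMorse u i = x
      rcases Nat.mod_two_eq_zero_or_one k with h0 | h0
      · have : (k + 1) % 2 = 1 := by omega
        simp [h0, this]
      · have : (k + 1) % 2 = 0 := by omega
        simp only [h0, this]
        revert x; decide
  have hlast := alt' p le_rfl
  rw [← h i le_rfl (by omega), Nat.odd_iff.1 hp] at hlast
  exact fin_two_add_one_ne _ hlast.symm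

theorem PeriodicOn.of_iterate_thueMorse {u : ℕ → Fin 2} (s : ℕ) {i m p : ℕ} (him : i + p < m)
    (h : PeriodicOn (InfWord.thueMorse^[s] u) i m p) :
    ∃ i' m' q, p = 2 ^ s * q ∧ 2 ^ s * i' ≤ i ∧ m ≤ 2 ^ s * m' ∧ i' + q < m' ∧
      PeriodicOn u i' m' q := by
  induction s generalizing i m p with
  | zero => exact ⟨i, m, p, by simp, by simp, by simp, him, h⟩
  | succ s ih =>
    rw [Function.iterate_succ_apply'] at h
    obtain ⟨r, rfl⟩ := (h.even_of_overlap him).two_dvd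
    obtain ⟨i', m', q, rfl, hi, hm, hlt, hper⟩ :=
      ih (by omega) (h.of_thueMorse (by omega))
    refine ⟨i', m', q, by ring, ?_, ?_, hlt, hper⟩
    · rw [pow_succ', mul_assoc]; omega
    · rw [pow_succ', mul_assoc]; omega

/-- A square prefix of an iterated Thue–Morse image has a long period. -/
theorem two_pow_le_of_square_prefix (k : ℕ) {u : ℕ → Fin 2} {p : ℕ} (hp : 0 < p)
    (h : PeriodicOn (thueMorse^[k + 1] u) 0 p p) : 2 ^ k ≤ p := by
  induction k generalizing p with
  | zero => exact hp
  | succ k ih =>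
    rw [Function.iterate_succ_apply'] at h
    rcases Nat.even_or_odd p with he | ho
    · obtain ⟨q, rfl⟩ := he.two_dvd
      have h' := h.of_thueMorse hp
      rw [show (2 * q + 1) / 2 = q by omega] at h'
      have := ih (by omega) h'
      rw [pow_succ']
      omega
    · exfalso
      rw [Function.iterate_succ_apply'] at h
      set v := thueMorse^[k] u
      obtain rfl | hp3 : p = 1 ∨ 3 ≤ p := by
        obtain ⟨q, rfl⟩ := ho
        omega
      · have h0 := h 0 le_rfl one_pos
        rw [thueMorse_succ_of_even _ Even.zero] at h0
        exact fin_two_add_one_ne _ h0.symm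
      -- Blocks of `μ²` have the form `abba`, so letters 1 and 2 agree; their translates by odd `p`
      -- form a block of `μ` and differ.
      · have h1 := h 1 (by omega) (by omega)
        have h2 := h 2 (by omega) (by omega)
        have h12 : thueMorse (thueMorse v) 1 = thueMorse (thueMorse v) 2 := by
          simp [thueMorse]
        rw [h1, h2, show 2 + p = 1 + p + 1 by ring,
          thueMorse_succ_of_even _ (odd_one.add_odd ho)] at h12
        exact fin_two_add_one_ne _ h12.symm

/-- The infinite word `w` with `w = 0 μˢ(w)`, where `μ` is the Thue–Morse morphism. -/
def overlapWord (s : ℕ) : ℕ → Fin 2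
  | 0 => 0
  | n + 1 => overlapWord s (n / 2 ^ s) + thueMorse^[s] (fun _ => 0) n
termination_by n => n
decreasing_by exact Nat.lt_succ_of_le (Nat.div_le_self _ _)

theorem overlapWord_succ (s n : ℕ) :
    overlapWord s (n + 1) = thueMorse^[s] (overlapWord s) n := by
  rw [overlapWord, ← iterate_thueMorse]

/-- The word starts `0 μˢ(0) μˢ(0)`, and the leading `0` is also the last letter of `μˢ(0)`. -/
theorem overlapWord_overlap_zero (k : ℕ) :
    PeriodicOn (overlapWord (2 * k)) 0 (2 ^ (2 * k) + 1) (2 ^ (2 * k)) := by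
  have hbase : PeriodicOn (overlapWord (2 * k)) 0 1 1 := by
    intro j _ hj
    obtain rfl : j = 0 := by omega
    rw [overlapWord_succ, iterate_thueMorse_zero]
  intro j _ hj
  cases j with
  | zero =>
    have := Nat.one_le_two_pow (n := 2 * k)
    have hlast := overlapWord_succ (2 * k) (2 ^ (2 * k) - 1)
    rw [Nat.sub_add_cancel this, iterate_thueMorse_last] at hlast
    rw [zero_add, hlast]
  | succ n =>
    rw [add_right_comm, overlapWord_succ, overlapWord_succ]
    simpa using hbase.iterate_thueMorse (2 * k) n (by simp) (by omega)

theorem exists_overlap_overlapWord (k i : ℕ) :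
    ∃ p, 0 < p ∧ PeriodicOn (overlapWord (2 * k)) i (i + p + 1) p := by
  induction i using Nat.strong_induction_on with
  | _ i ih =>
    cases i with
    | zero => exact ⟨2 ^ (2 * k), by positivity, by simpa using overlapWord_overlap_zero k⟩
    | succ n =>
      -- The one letter beyond the square becomes a whole block in the image, enough to start
      -- anywhere in the first block and still have an overlap.
      obtain ⟨p, hp, h⟩ := ih (n / 2 ^ (2 * k)) (Nat.lt_succ_of_le (Nat.div_le_self _ _))
      refine ⟨2 ^ (2 * k) * p, by positivity, fun j hj hm => ?_⟩
      obtain ⟨j, rfl⟩ : ∃ l, j = l + 1 := ⟨j - 1, by omega⟩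
      rw [add_right_comm, overlapWord_succ, overlapWord_succ]
      have hdiv := Nat.div_add_mod n (2 ^ (2 * k))
      have hmod := Nat.mod_lt n (Nat.two_pow_pos (2 * k))
      refine h.iterate_thueMorse (2 * k) j (by omega) ?_
      rw [mul_add, mul_add]
      omega

/-- The `+ 1` on the left is slack: desubstitution multiplies it by `2 ^ (s + 1) ≥ 2`, which pays
for the extra leading `0`. -/
theorem overlapWord_overlap_bound (s : ℕ) {i m p : ℕ} (hp : 0 < p) (him : i + p < m)
    (h : PeriodicOn (overlapWord (s + 1)) i m p) :
    2 ^ (s + 1) * (m + 1) ≤ 2 ^ (s + 1) * i + (2 ^ (s + 1) + 4) * p := by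
  induction p using Nat.strong_induction_on generalizing i m with
  | _ p ih =>
    have hN : 2 ≤ 2 ^ (s + 1) := by
      have := Nat.one_le_two_pow (n := s)
      rw [pow_succ']; omega
    have descend : ∀ i₁ m₁, i₁ + p < m₁ →
        PeriodicOn (thueMorse^[s + 1] (overlapWord (s + 1))) i₁ m₁ p →
        2 ^ (s + 1) * (m₁ + 2) ≤ 2 ^ (s + 1) * i₁ + (2 ^ (s + 1) + 4) * p := by
      intro i₁ m₁ him₁ h₁
      obtain ⟨i', m', q, hpq, hi, hm, hlt, hper⟩ := h₁.of_iterate_thueMorse (s + 1) him₁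
      generalize 2 ^ (s + 1) = N at *
      have hq : 0 < q := Nat.pos_of_ne_zero fun h0 => by simp [h0] at hpq; omega
      have := ih q (by nlinarith) hq hlt hper
      subst hpq
      nlinarith [Nat.mul_le_mul_left N this, Nat.mul_le_mul_left N hi,
        Nat.mul_le_mul_left N hm]
    have shift : ∀ i₁, i ≤ i₁ + 1 →
        PeriodicOn (thueMorse^[s + 1] (overlapWord (s + 1))) i₁ (m - 1) p := by
      intro i₁ hi₁ j hj hm
      rw [← overlapWord_succ, ← overlapWord_succ, add_right_comm]
      exact h (j + 1) (by omega) (by omega)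
    obtain ⟨m, rfl⟩ : ∃ l, m = l + 1 := ⟨m - 1, by omega⟩
    rcases i with _ | i
    · rcases Nat.lt_or_ge p m with hm | hm
      · have := descend 0 m (by omega) (shift 0 (by omega))
        simpa [add_assoc] using this
      -- Without the leading `0` only a square prefix of the image remains, so descent stops; its
      -- period is at least `2 ^ s`, whence the constant 4.
      · obtain rfl : m = p := by omega
        have := two_pow_le_of_square_prefix s hp (shift 0 (by omega))
        rw [pow_succ']
        nlinarith
    · have := descend i m (by omega) (shift i le_rfl)
      nlinarith

theorem subword_length {A : Type*} (a : ℕ → A) (i m : ℕ) : (subword a i m).length = m := by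
  simp [subword]

theorem IsPower.periodic {A : Type*} {w : List A} {β : ℚ} (hβ : 1 < β) (h : IsPower w β) :
    ∃ p : ℕ, 0 < p ∧ (w.length : ℚ) = β * p ∧
      ∀ k, k + p < w.length → w[k]? = w[k + p]? := by
  obtain ⟨x, x', n, hx, hx', rfl, rfl⟩ := h
  have hpos : 0 < x.length := List.length_pos_of_ne_nil hx
  have hne : (x.length : ℚ) ≠ 0 := by positivity
  refine ⟨x.length, hpos, ?_, ?_⟩
  · simp
    field_simp
  · cases n with
    | zero =>
      exfalso
      have : (x'.length : ℚ) ≤ x.length := by exact_mod_cast hx'.length_le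
      have : (x'.length : ℚ) / x.length ≤ 1 := div_le_one_of_le₀ this (by positivity)
      simp at hβ
      linarith
    | succ n =>
      intro k hk
      obtain ⟨y, rfl⟩ := hx'
      have hcons : (List.replicate (n + 1) (x' ++ y)).flatten ++ x'
          = (x' ++ y) ++ ((List.replicate n (x' ++ y)).flatten ++ x') := by
        simp [List.replicate_succ]
      have hsnoc : (List.replicate (n + 1) (x' ++ y)).flatten ++ x'
          = ((List.replicate n (x' ++ y)).flatten ++ x') ++ (y ++ x') := by
        simp [List.replicate_succ']
      generalize (List.replicate n (x' ++ y)).flatten ++ x' = v at hcons hsnoc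
      rw [hcons, List.length_append (as := x' ++ y)] at hk
      conv_rhs => rw [hcons, List.getElem?_append_right (by omega), Nat.add_sub_cancel]
      rw [hsnoc, List.getElem?_append_left (by omega)]

theorem isSquareWord_subword {A : Type*} {a : ℕ → A} {i p : ℕ} (hp : 0 < p)
    (h : ∀ j, i ≤ j → j < i + p → a j = a (j + p)) : IsSquareWord (subword a i (p + p)) := by
  refine ⟨subword a i p, [], 2, ?_, List.nil_prefix, ?_, by simp⟩
  · rw [← List.length_pos_iff_ne_nil, subword_length]
    exact hp
  · have : (List.range p).map (fun k => a (i + (p + k))) = (List.range p).map fun k => a (i + k) :=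
      List.map_congr_left fun k hk => by
        rw [h (i + k) (by omega) (by simpa using hk), add_assoc, add_comm p k]
    simp [subword, List.range_add, List.replicate_succ, Function.comp_def, this]

end InfWord

open InfWord in
theorem mainTheorem5 (α : ℝ) (hα : 2 < α) :
    ∃ a : ℕ → Fin 2, InfWord.PowerFree a α ∧ ∀ i : ℕ, InfWord.HasSquareAt a i := by
  -- With `N ≥ 2 ^ k` this gives `4 / N < α - 2`.
  obtain ⟨k, hk⟩ := pow_unbounded_of_one_lt (4 / (α - 2)) (one_lt_two (α := ℝ))
  refine ⟨overlapWord (2 * (k + 1)), ?_, fun i => ?_⟩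
  · intro β hβ i m hpow
    have hβ2 : (2 : ℝ) < β := hα.trans_le hβ
    have hβ1 : (1 : ℚ) < β := by
      have : (1 : ℝ) < β := by linarith
      exact_mod_cast this
    obtain ⟨p, hp, hlen, hper⟩ := hpow.periodic hβ1
    rw [subword_length] at hlen hper
    have hlen' : (m : ℝ) = β * p := by exact_mod_cast congrArg (Rat.cast (K := ℝ)) hlen
    have hp' : (0 : ℝ) < p := by exact_mod_cast hp
    have hm : p + p < m := by
      have : (p : ℝ) + p < m := by nlinarith
      exact_mod_cast this
    have hP : PeriodicOn (overlapWord (2 * (k + 1))) i (i + m - p) p := by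
      intro j hj hjm
      have h1 := hper (j - i) (by omega)
      have e1 : i + (j - i) = j := by omega
      have e2 : i + (j - i + p) = j + p := by omega
      simpa [subword, List.getElem?_range, show j - i < m by omega,
        show j - i + p < m by omega, e1, e2] using h1
    have hb := overlapWord_overlap_bound (2 * k + 1) hp (by omega) hP
    obtain ⟨l, rfl⟩ : ∃ l, m = l + p := ⟨m - p, by omega⟩
    rw [show i + (l + p) - p = i + l by omega] at hb
    have hN : (2 : ℝ) ^ k ≤ 2 ^ (2 * k + 1 + 1) :=
      pow_le_pow_right₀ one_le_two (by omega)
    have hb' : (2 : ℝ) ^ (2 * k + 1 + 1) * (i + l + 1)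
        ≤ 2 ^ (2 * k + 1 + 1) * i + (2 ^ (2 * k + 1 + 1) + 4) * p := by exact_mod_cast hb
    rw [div_lt_iff₀ (by linarith)] at hk
    generalize (2 : ℝ) ^ (2 * k + 1 + 1) = N at *
    have hN0 : (0 : ℝ) < N := lt_of_lt_of_le (by positivity) hN
    have h4 : 4 < N * (β - 2) := by nlinarith
    push_cast at hlen'
    have h5 : N * (l + p) = N * (β * p) := by rw [hlen']
    nlinarith [mul_lt_mul_of_pos_right h4 hp']
  · obtain ⟨p, hp, h⟩ := exists_overlap_overlapWord (k + 1) i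
    exact ⟨p + p, isSquareWord_subword hp fun j hj hjp => h j hj (by omega)⟩
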